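/- Let $\Phi$ be a reduced, irreducible, crystallographic finite root system with simple roots $\alpha_i$ ($i\in I^*=\{1,\dots,n\}$), positive roots $\Phi^+$, highest root $\theta$, and finite Weyl group $W$ with length function $\ell$; write $(x,\alpha)$ for the pairing of a point $x$ of the Euclidean space $V$ with a root $\alpha$. Let $W$ act on $V$ on the right, with $(x)s_\alpha=x-(x,\alpha)\alpha^\vee$. Let $Q^\vee$ be the coroot lattice and $W_a=W\ltimes Q^\vee$, acting on $V$ on the right with $(x)t_\beta=x+\beta$ for $\beta\in Q^\vee$. Every $w\in W_a$ is uniquely $w=\mathsf f(w)t_{\mathsf{wt}(w)}$ with $\mathsf f(w)\in W$, $\mathsf{wt}(w)\in Q^\vee$. Put $I=I^*\cup\{0\}$, $s_i=s_{\alpha_i}$ for $i\in I^*$, $s_0=s_\theta t_{\theta^\vee}$, $a_0=1$, and define $a_i$ for $i\in I^*$ by $\theta=\sum_{i\in I^*}a_i\alpha_i$. Identify $w\in W_a$ with the alcove $A_0w$, where $A_0=\{x\in V: 0<(x,\alpha)<1\ \ \forall\alpha\in\Phi^+\}$. For $\alpha\in\Phi^+$ and $k\in\mathbb Z$ let $H_{\alpha,k}=\{x:(x,\alpha)=k\}$,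 $H_{\alpha,k}^{+}=\{x:(x,\alpha)>k\}$ and $H_{\alpha,k}^{-}=\{x:(x,\alpha)<k\}$. If $H$ is the unique hyperplane $H_{\alpha,k}$ separating the alcoves $w$ and $s_iw$, the crossing from $w$ to $s_iw$ is positive if $w\subset H^-$ and $s_iw\subset H^+$, and negative if $w\subset H^+$ and $s_iw\subset H^-$. Let $J\subseteq I^*$ and $\gamma=\sum_{i\in I^*\setminus J}\omega_i$, where the $\omega_i$ are the fundamental weights. Let $W_J=\langle s_j: j\in J\rangle$, let $W^J$ be the set of minimal length representatives of $W/W_J$, and write $x=x^Jx_J$ with $x^J\in W^J$, $x_J\in W_J$ for $x\in W$. Let $\Phi_J^+$ be the set of positive roots in the span of $\{\alpha_j: j\in J\}$, and let $\mathcal A_J=\{x\in V: 0<(x,\alpha)<1\ \ \forall\alpha\in\Phi_J^+\}$; we write $w\in\mathcal A_J$ when the alcove $w$ is contained in $\mathcal A_J$. Let $Q_J^\vee=\bigoplus_{j\in J}\mathbb Z\alpha_j^\vee$, and let $\overline\alpha$ be the class of $\alpha\in Q^\vee$ in $Q^\vee/Q_J^\vee$. The graph $\Gamma_\gamma$ is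 the oriented graph with vertex set $W^J$, weights in the group algebra $\mathbb Z[Q^\vee/Q_J^\vee]=\bigoplus_{\overline\alpha}\mathbb Z\,\mathsf z^{\overline\alpha}$, and exactly the following arrows: for $i\in I^*$, an arrow $u\to s_iu$ of type $i$ and weight $a_i=a_i\mathsf z^{\overline 0}$ whenever $u,s_iu\in W^J$ and $\ell(s_iu)=\ell(u)+1$; and an arrow $u\to\mathsf f(s_0u)^J$ of type $0$ and weight $\mathsf z^{\overline{\mathsf{wt}(s_0u)}}$ whenever $u\in W^J$ and $\ell(\mathsf f(s_0u)^J)<\ell(u)$. **Theorem.** Let $w\in W_a$ with $w\in\mathcal A_J$ and let $i\in I$. Then $s_iw\in\mathcal A_J$ if and only if some arrow of type $i$ of $\Gamma_\gamma$ starts or ends at $\mathsf f(w)^J$. In this case there is an arrow of type $i$, with weight of the form $a_i\mathsf z^{\overline\alpha}$ for some $\alpha\in Q^\vee$, between $\mathsf f(w)^J$ and $\mathsf f(s_iw)^J$ in one of the two directions, and for every $\alpha\in Q^\vee$: 1. if there is an arrow of type $i$ and weight $a_i\mathsf z^{\overline\alpha}$ from $\mathsf f(w)^J$ to $\mathsf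 f(s_iw)^J$, then $\overline{\mathsf{wt}(s_iw)}=\overline{\mathsf{wt}(w)+\alpha}$ and the crossing from $w$ to $s_iw$ is negative; 2. if there is an arrow of type $i$ and weight $a_i\mathsf z^{\overline\alpha}$ from $\mathsf f(s_iw)^J$ to $\mathsf f(w)^J$, then $\overline{\mathsf{wt}(s_iw)}=\overline{\mathsf{wt}(w)-\alpha}$ and the crossing from $w$ to $s_iw$ is positive. -/

import Mathlib

noncomputable section

namespace JAlcove

open MulOpposite

variable {ι M N : Type*} [AddCommGroup M] [Module ℝ M] [AddCommGroup N] [Module ℝ N]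

/-! Throughout, `P` is a root system `Φ ⊂ M` with coroots in `N`; the alcoves live in `V = N`, and
`(x, α)` is the pairing of `x ∈ V` with the root `α`. The finite Weyl group `W = P.weylGroup` acts
on `V` on the right: `(x)u = op u • x`, so that `(x)(uv) = ((x)u)v`, `(x)s_α = x - (x, α) α^∨`, and
`((x)u, α) = (x, u(α))`. -/

section WeylGroup

variable {P : RootPairing ι ℝ M N}

/-- The right action `x ↦ (x)u` of the finite Weyl group on `V`. -/
def rightW (x : N) (u : P.weylGroup) : N := op (u : P.Aut) • x

lemma rightW_one (x : N) : rightW x (1 : P.weylGroup) = x := one_smul _ x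

lemma rightW_mul (x : N) (u v : P.weylGroup) : rightW x (u * v) = rightW (rightW x u) v := by
  simp only [rightW, Subgroup.coe_mul, op_mul, mul_smul]

lemma rightW_add (x y : N) (u : P.weylGroup) : rightW (x + y) u = rightW x u + rightW y u :=
  smul_add _ _ _

lemma rightW_neg (x : N) (u : P.weylGroup) : rightW (-x) u = -rightW x u := smul_neg _ _

lemma rightW_coroot (i : ι) (u : P.weylGroup) :
    rightW (P.coroot i) u = P.coroot ((u : P.Aut).indexEquiv.symm i) :=
  congrFun (u : P.Aut).coroot_coweightMap i

lemma rightW_mem (x : N) (hx : x ∈ P.corootSpan ℤ) (u : P.weylGroup) :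
    rightW x u ∈ P.corootSpan ℤ := by
  induction hx using Submodule.span_induction with
  | mem x hx =>
    obtain ⟨i, rfl⟩ := hx
    rw [rightW_coroot]
    exact Submodule.subset_span ⟨_, rfl⟩
  | zero => rw [rightW, smul_zero]; exact zero_mem _
  | add x y _ _ hx hy => rw [rightW_add]; exact add_mem hx hy
  | smul a x _ hx =>
    have : rightW (a • x) u = a • rightW x u :=
      map_zsmul (DistribSMul.toAddMonoidHom N (op (u : P.Aut))) a x
    rw [this]
    exact Submodule.smul_mem _ _ hx

end WeylGroup

section AffineWeylGroup

/-- The affine Weyl group `W_a = W ⋉ Q^∨`: the element `⟨u, β⟩` is `u t_β`, with `u ∈ W` and `β` in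
the coroot lattice `Q^∨ = P.corootSpan ℤ`. For `w = u t_β`, `w.f = u` and `w.wt = β`. -/
@[ext] structure AffineWeyl (P : RootPairing ι ℝ M N) where
  /-- the finite part `f(w)` -/
  f : P.weylGroup
  /-- the weight `wt(w)` -/
  wt : P.corootSpan ℤ

variable {P : RootPairing ι ℝ M N}

/-- The product of `W_a`: `(u t_β)(v t_β') = (uv) t_{(β)v + β'}`. -/
instance : Mul (AffineWeyl P) where
  mul w w' := ⟨w.f * w'.f, ⟨rightW (w.wt : N) w'.f + w'.wt,
    add_mem (rightW_mem _ w.wt.2 _) w'.wt.2⟩⟩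

instance : One (AffineWeyl P) := ⟨⟨1, 0⟩⟩

instance : Inv (AffineWeyl P) where
  inv w := ⟨w.f⁻¹, ⟨rightW (-(w.wt : N)) w.f⁻¹, rightW_mem _ (neg_mem w.wt.2) _⟩⟩

@[simp] lemma mul_f (w w' : AffineWeyl P) : (w * w').f = w.f * w'.f := rfl

@[simp] lemma coe_mul_wt (w w' : AffineWeyl P) :
    ((w * w').wt : N) = rightW (w.wt : N) w'.f + w'.wt := rfl

@[simp] lemma one_f : (1 : AffineWeyl P).f = 1 := rfl

@[simp] lemma one_wt : (1 : AffineWeyl P).wt = 0 := rfl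

instance : Group (AffineWeyl P) := Group.ofLeftAxioms
  (fun a b c ↦ AffineWeyl.ext (mul_assoc _ _ _) (Subtype.ext (by
    simp only [coe_mul_wt, mul_f, rightW_mul, rightW_add, add_assoc])))
  (fun a ↦ AffineWeyl.ext (one_mul _) (Subtype.ext (by
    simp only [coe_mul_wt, one_wt, ZeroMemClass.coe_zero]
    rw [rightW, smul_zero, zero_add])))
  (fun a ↦ AffineWeyl.ext (inv_mul_cancel _) (Subtype.ext (by
    change rightW (rightW (-(a.wt : N)) a.f⁻¹) a.f + a.wt = 0
    rw [← rightW_mul, inv_mul_cancel, rightW_one, neg_add_cancel])))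

/-- The right action of `W_a` on `V` by affine motions: `(x)(u t_β) = (x)u + β`. -/
def act (x : N) (w : AffineWeyl P) : N := rightW x w.f + w.wt

lemma act_mul (x : N) (w w' : AffineWeyl P) : act x (w * w') = act (act x w) w' := by
  simp only [act, mul_f, coe_mul_wt, rightW_mul, rightW_add, add_assoc]

/-- The inclusion `W ⊂ W_a`. -/
def ofW (u : P.weylGroup) : AffineWeyl P := ⟨u, 0⟩

end AffineWeylGroup

section Simple

variable {P : RootPairing ι ℝ M N} (b : P.Base)

/-- The highest root `θ`, that is, the root of greatest height. -/
def highestRoot [Finite ι] [Nonempty ι] : ι := (Finite.exists_max b.height).choose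

lemma height_le_highestRoot [Finite ι] [Nonempty ι] (i : ι) :
    b.height i ≤ b.height (highestRoot b) :=
  (Finite.exists_max b.height).choose_spec i

/-- The simple reflection `s_i ∈ W`, for `i ∈ I^* = b.support`. -/
def simpleW (i : b.support) : P.weylGroup := RootPairing.weylGroup.ofIdx P i

/-- The Coxeter generators of `W_a`, indexed by `I = I^* ∪ {0}`: `some i` stands for `i ∈ I^*`, and
`none` for the index `0`, with `s_0 = s_θ t_{θ^∨}`. -/
def simpleA [Finite ι] [Nonempty ι] : Option b.support → AffineWeyl P
  | some i => ofW (simpleW b i)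
  | none => ⟨RootPairing.weylGroup.ofIdx P (highestRoot b),
      ⟨P.coroot (highestRoot b), Submodule.subset_span ⟨_, rfl⟩⟩⟩

/-- The marks `a_i`, `i ∈ I`, of the affine root system: `a_0 = 1` and `θ = ∑_{i ∈ I^*} a_i α_i`. -/
def mark [Finite ι] [Nonempty ι] : Option b.support → ℤ
  | some i => b.toWeightBasisInt.repr (P.rootSpanMem ℤ (highestRoot b)) i
  | none => 1

/-- The Coxeter length `ℓ(u)` on `W`: the least length of a word in the simple reflections with
product `u`. -/
def length (u : P.weylGroup) : ℕ :=
  sInf {k | ∃ l : List b.support, l.length = k ∧ (l.map (simpleW b)).prod = u}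

end Simple

section Parabolic

variable {P : RootPairing ι ℝ M N} (b : P.Base) (J : Set b.support)

/-- The standard parabolic subgroup `W_J`, generated by the `s_j` with `j ∈ J`. -/
def parabolic : Subgroup P.weylGroup := Subgroup.closure (simpleW b '' J)

/-- `W^J`: the elements of `W` of minimal length in their coset `u W_J`. -/
def minReps : Set P.weylGroup := {u | ∀ v ∈ parabolic b J, length b u ≤ length b (u * v)}

lemma exists_minRep (x : P.weylGroup) :
    ∃ u : minReps b J, ∃ v ∈ parabolic b J, x = u * v := by
  let g : parabolic b J → ℕ := fun v ↦ length b (x * v)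
  have hmin (v' : parabolic b J) : g (Function.argmin g) ≤ g v' := Function.argmin_le g v'
  refine ⟨⟨x * (Function.argmin g : parabolic b J), fun v' hv' ↦ ?_⟩,
    (Function.argmin g : parabolic b J)⁻¹, Subgroup.inv_mem _ (Subtype.prop _), by simp⟩
  have h := hmin (Function.argmin g * ⟨v', hv'⟩)
  rw [mul_assoc]
  exact h

/-- `x ↦ x^J`, where `x = x^J x_J` with `x^J ∈ W^J` and `x_J ∈ W_J`. -/
def minRep (x : P.weylGroup) : minReps b J := (exists_minRep b J x).choose

/-- The sublattice `Q_J^∨` of `Q^∨` spanned by the simple coroots `α_j^∨`, `j ∈ J`. -/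
def corootLatticeJ : Submodule ℤ (P.corootSpan ℤ) :=
  Submodule.span ℤ {β | ∃ j ∈ J, (β : N) = P.coroot j}

/-- The class of `β ∈ Q^∨` in `Q^∨ / Q_J^∨`. -/
def cls (β : P.corootSpan ℤ) : P.corootSpan ℤ ⧸ corootLatticeJ b J :=
  (corootLatticeJ b J).mkQ β

/-- The group algebra `ℤ[Q^∨ / Q_J^∨]`. -/
abbrev WeightRing := AddMonoidAlgebra ℤ (P.corootSpan ℤ ⧸ corootLatticeJ b J)

/-- The element `a z^{β̄}` of `ℤ[Q^∨ / Q_J^∨]`, with `a ∈ ℤ` and `β ∈ Q^∨`. -/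
def monomial (a : ℤ) (β : P.corootSpan ℤ) : WeightRing b J :=
  AddMonoidAlgebra.single (cls b J β) a

/-- The oriented weighted graph `Γ_γ` of `γ = ∑_{i ∈ I^* ∖ J} ω_i`; its vertices are the elements of
`W^J`, and `Arrow b J i c u v` says that there is an arrow of type `i` and weight `c` from `u`
to `v`. -/
inductive Arrow [Finite ι] [Nonempty ι] :
    Option b.support → WeightRing b J → minReps b J → minReps b J → Prop
  | finite (i : b.support) (u : minReps b J) (hmem : simpleW b i * u ∈ minReps b J)
      (hlen : length b (simpleW b i * u) = length b u + 1) :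
      Arrow (some i) (monomial b J (mark b (some i)) 0) u ⟨simpleW b i * u, hmem⟩
  | zero (u : minReps b J)
      (hlen : length b (minRep b J (simpleA b none * ofW (u : P.weylGroup)).f) < length b u) :
      Arrow none (monomial b J 1 (simpleA b none * ofW (u : P.weylGroup)).wt) u
        (minRep b J (simpleA b none * ofW (u : P.weylGroup)).f)

end Parabolic

section Alcoves

variable {P : RootPairing ι ℝ M N} (b : P.Base)

/-- The fundamental alcove `A_0`. -/
def fundAlcove : Set N := {x | ∀ i, b.IsPos i → 0 < P.root' i x ∧ P.root' i x < 1}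

/-- The alcove `A_0 w` identified with `w ∈ W_a`. -/
def alcove (w : AffineWeyl P) : Set N := (fun x ↦ act x w) '' fundAlcove b

/-- The region `{x ∈ V | 0 < (x, α) < 1 for all α ∈ Φ_J^+}`, where `Φ_J^+` is the set of positive
roots in the span of the simple roots `α_j`, `j ∈ J`. -/
def jRegion (J : Set b.support) : Set N :=
  {x | ∀ i, b.IsPos i → P.root i ∈ Submodule.span ℝ ((fun j : b.support ↦ P.root j) '' J) →
    0 < P.root' i x ∧ P.root' i x < 1}

/-- The fundamental `J`-alcove `𝒜_J`, as a set of alcoves, i.e. of elements of `W_a`. -/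
def fundJAlcove (J : Set b.support) : Set (AffineWeyl P) := {w | alcove b w ⊆ jRegion b J}

/-- The side `H_{α,k}^+` of the hyperplane `H_{α,k}`, where `α` is the root of index `i`. -/
def posSide (P : RootPairing ι ℝ M N) (i : ι) (k : ℤ) : Set N := {x | (k : ℝ) < P.root' i x}

/-- The side `H_{α,k}^-` of the hyperplane `H_{α,k}`, where `α` is the root of index `i`. -/
def negSide (P : RootPairing ι ℝ M N) (i : ι) (k : ℤ) : Set N := {x | P.root' i x < (k : ℝ)}

/-- The hyperplane `H_{α,k}` (`α ∈ Φ^+` of index `i`, `k ∈ ℤ`) separates the alcoves `w`, `w'`. -/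
def Separates (i : ι) (k : ℤ) (w w' : AffineWeyl P) : Prop :=
  b.IsPos i ∧ ((alcove b w ⊆ negSide P i k ∧ alcove b w' ⊆ posSide P i k) ∨
    (alcove b w ⊆ posSide P i k ∧ alcove b w' ⊆ negSide P i k))

/-- `H_{α,k}` is the unique hyperplane separating the alcoves `w` and `w'`. -/
def IsUniqueSeparator (i : ι) (k : ℤ) (w w' : AffineWeyl P) : Prop :=
  Separates b i k w w' ∧ ∀ i' k', Separates b i' k' w w' → i' = i ∧ k' = k

/-- The crossing from `w` to the adjacent alcove `w'` is positive. -/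
def PositiveCrossing (w w' : AffineWeyl P) : Prop :=
  ∃ i k, IsUniqueSeparator b i k w w' ∧ alcove b w ⊆ negSide P i k ∧ alcove b w' ⊆ posSide P i k

/-- The crossing from `w` to the adjacent alcove `w'` is negative. -/
def NegativeCrossing (w w' : AffineWeyl P) : Prop :=
  ∃ i k, IsUniqueSeparator b i k w w' ∧ alcove b w ⊆ posSide P i k ∧ alcove b w' ⊆ negSide P i k

end Alcoves

end JAlcove

end

/-! For an alcove `w` and a root `α_j` there is an integer `level w j` such that `w` lies in the strip
`level w j < (x, α_j) < level w j + 1`; it is `(wt(w), α_j)`, lowered by one if `f(w) α_j` is negative.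
Hence `H_{α_j,k}` separates two alcoves exactly when `k` lies between their levels
(`separates_iff`), and `w ∈ 𝒜_J` means that all levels at the positive roots of `Φ_J` vanish
(`mem_fundJAlcove_iff`). Let `ᾱ_i` be `α_i` for `i ∈ I^*` and `-θ` for `i = 0`, and put
`β = f(w)⁻¹ ᾱ_i`. Passing from `w` to `s_i w` lowers the level at `β` by one, raises the level at `-β`
by one and changes no other level (`level_simpleA_mul`); for `i = 0` this rests on
`⟨α, θ^∨⟩ ∈ {0, 1}` for the positive roots `α ≠ θ`, which follows from `θ` having the greatest height.
So, given `w ∈ 𝒜_J`, one has `s_i w ∈ 𝒜_J` if and only if `β ∉ Φ_J`, and the crossing is negative if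
`β` is positive and positive if `β` is negative.

On the side of the graph, there is an arrow of type `i` from `u^J` exactly when `u⁻¹ ᾱ_i` is a positive
root outside `Φ_J`, and it ends at `f(s_i u)^J` (`arrow_iff`, `arrow_minRep_iff`). This needs the
exchange condition (`exists_shorter_word`), the description of `W^J` as the set of `u` with
`u α_j > 0` for `j ∈ J` (`mem_minReps_iff`), and the fact that `W_J` permutes the positive roots
outside `Φ_J` (`isPos_smul_of_not_inJ`); the coset `u W_J` determines the class of the weight since
`W_J` acts trivially on `Q^∨ / Q_J^∨` (`cls_rightQ`). With `u = f(w)` both sides speak of the same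
root `β`. The weight `a_i z^ᾱ` determines `ᾱ` because the marks `a_i` are nonzero (`mark_ne_zero`),
which is where irreducibility enters. An arrow from `f(s_i w)^J` to `f(w)^J` is treated by
exchanging the roles of `w` and `s_i w`. -/

noncomputable section

namespace JAlcove

open MulOpposite RootPairing

/-! ### The Weyl group acting on indices of roots -/

section Reflections

variable {ι M N : Type*} [AddCommGroup M] [Module ℝ M] [AddCommGroup N] [Module ℝ N]
  {P : RootPairing ι ℝ M N}

lemma root_smul (u : P.weylGroup) (i : ι) : P.root (u • i) = u • P.root i :=
  Equiv.root_indexEquiv_eq_smul P i (u : P.Aut)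

lemma ofIdx_smul_index (i j : ι) : weylGroup.ofIdx P i • j = P.reflectionPerm i j := rfl

/-- The index of the root opposite to the root of index `i`. -/
def negIdx (P : RootPairing ι ℝ M N) (i : ι) : ι := P.reflectionPerm i i

@[simp] lemma root_negIdx (i : ι) : P.root (negIdx P i) = -P.root i := by simp [negIdx]

@[simp] lemma negIdx_negIdx (i : ι) : negIdx P (negIdx P i) = i := by
  apply P.root.injective
  simp

lemma smul_negIdx (u : P.weylGroup) (i : ι) : u • negIdx P i = negIdx P (u • i) := by
  apply P.root.injective
  simp [root_smul]

lemma ofIdx_smul_self (i : ι) : weylGroup.ofIdx P i • i = negIdx P i := rfl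

lemma eq_negIdx_comm {i j : ι} : i = negIdx P j ↔ j = negIdx P i := by
  constructor <;> rintro rfl <;> simp

/-- The Weyl group acts faithfully on the weight space. -/
lemma weylGroup_ext {u v : P.weylGroup} (h : ∀ m : M, u • m = v • m) : u = v :=
  Subtype.ext (Equiv.weightHom_injective P (LinearEquiv.ext h))

lemma ofIdx_smul_weight (i : ι) (m : M) : weylGroup.ofIdx P i • m = P.reflection i m := rfl

lemma ofIdx_mul_self (i : ι) : weylGroup.ofIdx P i * weylGroup.ofIdx P i = 1 :=
  weylGroup_ext fun m ↦ by simp [mul_smul]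

lemma ofIdx_inv (i : ι) : (weylGroup.ofIdx P i)⁻¹ = weylGroup.ofIdx P i :=
  inv_eq_of_mul_eq_one_left (ofIdx_mul_self i)

/-- A reflection conjugated by a reflection is the reflection in the reflected root. -/
lemma ofIdx_ofIdx_smul (i j : ι) : weylGroup.ofIdx P (weylGroup.ofIdx P i • j) =
    weylGroup.ofIdx P i * weylGroup.ofIdx P j * weylGroup.ofIdx P i :=
  weylGroup_ext fun m ↦ by
    simp only [mul_smul, ofIdx_smul_weight, ofIdx_smul_index, reflection_reflectionPerm]
    rfl

lemma ofIdx_negIdx (i : ι) : weylGroup.ofIdx P (negIdx P i) = weylGroup.ofIdx P i := by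
  rw [← ofIdx_smul_self, ofIdx_ofIdx_smul, ofIdx_mul_self, one_mul]

lemma inv_smul_ofIdx (u : P.weylGroup) (i : ι) :
    (weylGroup.ofIdx P i * u)⁻¹ • i = negIdx P (u⁻¹ • i) := by
  rw [mul_inv_rev, mul_smul, ofIdx_inv, ofIdx_smul_self, smul_negIdx]

variable (b : P.Base)

variable {b} in
lemma isPos_negIdx {i : ι} : b.IsPos (negIdx P i) ↔ ¬ b.IsPos i := Base.IsPos.neg_iff_not b i

variable [Finite ι] [P.IsCrystallographic] [P.IsReduced]

variable {b} in
/-- A simple reflection permutes the positive roots other than its own root. -/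
lemma isPos_simpleW_smul {i : ι} (k : b.support) (hi : b.IsPos i) (hik : i ≠ k) :
    b.IsPos (simpleW b k • i) := hi.reflectionPerm k.2 hik

/-! ### Length and the exchange condition -/

lemma closure_simpleW : Subgroup.closure (Set.range (simpleW b)) = ⊤ := by
  set H := Subgroup.closure (Set.range (simpleW b)) with hH
  have hs (k : b.support) : simpleW b k ∈ H := Subgroup.subset_closure ⟨k, rfl⟩
  have hr (i : ι) : weylGroup.ofIdx P i ∈ H := by
    refine b.induction_reflect i (p := fun i ↦ weylGroup.ofIdx P i ∈ H) (fun i hi ↦ ?_)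
      (fun i hi ↦ hs ⟨i, hi⟩) (fun i j hi hj ↦ ?_)
    · rw [← negIdx, ofIdx_negIdx]; exact hi
    · rw [← ofIdx_smul_index, ofIdx_ofIdx_smul]
      exact mul_mem (mul_mem (hs ⟨j, hj⟩) hi) (hs ⟨j, hj⟩)
  rw [eq_top_iff]
  rintro ⟨u, hu⟩ -
  induction hu using weylGroup.induction with
  | mem i => exact hr i
  | one => exact one_mem H
  | mul x y hx hy hx' hy' => exact mul_mem hx' hy'

lemma exists_word (u : P.weylGroup) : ∃ l : List b.support, (l.map (simpleW b)).prod = u := by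
  have hu : u ∈ Subgroup.closure (Set.range (simpleW b)) := closure_simpleW b ▸ Subgroup.mem_top u
  induction hu using Subgroup.closure_induction'' with
  | mem x hx => obtain ⟨k, rfl⟩ := hx; exact ⟨[k], by simp⟩
  | inv_mem x hx => obtain ⟨k, rfl⟩ := hx; exact ⟨[k], by simp [simpleW, ofIdx_inv]⟩
  | one => exact ⟨[], rfl⟩
  | mul x y _ _ hx hy =>
    obtain ⟨l, rfl⟩ := hx
    obtain ⟨l', rfl⟩ := hy
    exact ⟨l ++ l', by simp⟩

lemma exists_reduced_word (u : P.weylGroup) :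
    ∃ l : List b.support, l.length = length b u ∧ (l.map (simpleW b)).prod = u := by
  obtain ⟨l, hl⟩ := exists_word b u
  exact Nat.sInf_mem (s := {k | ∃ l : List b.support, l.length = k ∧ (l.map (simpleW b)).prod = u})
    ⟨_, l, rfl, hl⟩

omit [Finite ι] [P.IsCrystallographic] [P.IsReduced] in
lemma length_prod_le (l : List b.support) : length b (l.map (simpleW b)).prod ≤ l.length :=
  Nat.sInf_le ⟨l, rfl, rfl⟩

lemma length_inv_le (u : P.weylGroup) : length b u⁻¹ ≤ length b u := by
  obtain ⟨l, hl, rfl⟩ := exists_reduced_word b u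
  rw [← hl, ← l.length_reverse]
  convert length_prod_le b l.reverse using 2
  simp [List.prod_inv_reverse, Function.comp_def, simpleW, ofIdx_inv]

lemma length_inv (u : P.weylGroup) : length b u⁻¹ = length b u :=
  (length_inv_le b u).antisymm (by simpa using length_inv_le b u⁻¹)

lemma length_simpleW_mul_le (k : b.support) (u : P.weylGroup) :
    length b (simpleW b k * u) ≤ length b u + 1 := by
  obtain ⟨l, hl, rfl⟩ := exists_reduced_word b u
  rw [← hl]
  simpa using length_prod_le b (k :: l)

/-- The exchange condition: if `u⁻¹` sends a positive root `α` to a negative one, a word for `s_α u`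
arises from any word for `u` by omitting a letter. -/
lemma exists_shorter_word (l : List b.support) {i : ι} (hi : b.IsPos i)
    (hneg : ¬ b.IsPos ((l.map (simpleW b)).prod⁻¹ • i)) :
    ∃ l' : List b.support, l'.length + 1 = l.length ∧
      (l'.map (simpleW b)).prod = weylGroup.ofIdx P i * (l.map (simpleW b)).prod := by
  induction l generalizing i with
  | nil => simp [hi] at hneg
  | cons k l ih =>
    by_cases hik : i = k
    · refine ⟨l, rfl, ?_⟩
      rw [List.map_cons, List.prod_cons, ← mul_assoc, hik, simpleW, ofIdx_mul_self, one_mul]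
    · obtain ⟨l', hlen, hl'⟩ := ih (isPos_simpleW_smul k hi hik) (by
        simpa [mul_smul, simpleW, ofIdx_inv] using hneg)
      refine ⟨k :: l', by simpa using hlen, ?_⟩
      rw [List.map_cons, List.prod_cons, hl', List.map_cons, List.prod_cons, simpleW,
        ofIdx_ofIdx_smul]
      simp only [← mul_assoc, ofIdx_mul_self, one_mul]

lemma length_ofIdx_mul_lt {u : P.weylGroup} {i : ι} (hi : b.IsPos i) (hneg : ¬ b.IsPos (u⁻¹ • i)) :
    length b (weylGroup.ofIdx P i * u) < length b u := by
  obtain ⟨l, hl, rfl⟩ := exists_reduced_word b u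
  obtain ⟨l', hlen, hl'⟩ := exists_shorter_word b l hi hneg
  rw [← hl', ← hl, ← hlen]
  exact Nat.lt_succ_of_le (length_prod_le b l')

lemma length_lt_ofIdx_mul {u : P.weylGroup} {i : ι} (hi : b.IsPos i) (hpos : b.IsPos (u⁻¹ • i)) :
    length b u < length b (weylGroup.ofIdx P i * u) := by
  have h := length_ofIdx_mul_lt b (u := weylGroup.ofIdx P i * u) hi (by
    rwa [inv_smul_ofIdx, isPos_negIdx, not_not])
  rwa [← mul_assoc, ofIdx_mul_self, one_mul] at h

lemma length_mul_simpleW_lt {u : P.weylGroup} (k : b.support) (hneg : ¬ b.IsPos (u • (k : ι))) :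
    length b (u * simpleW b k) < length b u := by
  have h := length_ofIdx_mul_lt b (u := u⁻¹) (Base.isPos_of_mem_support k.2) (by rwa [inv_inv])
  rwa [← length_inv b u, ← length_inv b (u * simpleW b k), mul_inv_rev, simpleW, ofIdx_inv]

/-- A Weyl group element keeping all simple roots positive is trivial. -/
lemma eq_one_of_forall_isPos {u : P.weylGroup} (h : ∀ k : b.support, b.IsPos (u • (k : ι))) :
    u = 1 := by
  obtain ⟨l, hl, hu⟩ := exists_reduced_word b u⁻¹
  cases l with
  | nil => rw [← inv_inv u, ← hu]; simp
  | cons k l =>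
    have hlt := length_lt_ofIdx_mul b (u := u⁻¹) (Base.isPos_of_mem_support k.2)
      (by simpa using h k)
    have hle := length_prod_le b l
    rw [← hu, List.map_cons, List.prod_cons, ← mul_assoc, simpleW, ofIdx_mul_self, one_mul] at hlt
    rw [← simpleW, ← List.prod_cons, ← List.map_cons, hu, ← hl] at hlt
    simp only [List.length_cons] at hlt
    omega

end Reflections

/-! ### Parabolic subgroups and minimal coset representatives -/

section Cosets

variable {ι M N : Type*} [AddCommGroup M] [Module ℝ M] [AddCommGroup N] [Module ℝ N]
  {P : RootPairing ι ℝ M N} (b : P.Base) (J : Set b.support)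

/-- The real span of the simple roots `α_j`, `j ∈ J`. -/
def spanJ : Submodule ℝ M := Submodule.span ℝ ((fun j : b.support ↦ P.root j) '' J)

/-- The roots in the span of the `α_j`, `j ∈ J`, that is, the roots of `Φ_J`. -/
def InJ (i : ι) : Prop := P.root i ∈ spanJ b J

/-- The elements of `W` that act trivially on `M` modulo the span of the `α_j`, `j ∈ J`. This group
is `W_J`, but only the inclusion `parabolic_le_fixModJ` is needed: membership of a given element is
read off from its action, without a factorization into simple reflections. -/
def fixModJ : Subgroup P.weylGroup where
  carrier := {x | ∀ m : M, x • m - m ∈ spanJ b J}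
  one_mem' m := by simp
  mul_mem' {x y} hx hy m := by
    simpa [mul_smul] using add_mem (hx (y • m)) (hy m)
  inv_mem' {x} hx m := by
    simpa using neg_mem (hx (x⁻¹ • m))

variable {b J}

lemma inJ_simple {j : b.support} (hj : j ∈ J) : InJ b J j := Submodule.subset_span ⟨j, hj, rfl⟩

lemma inJ_negIdx {i : ι} : InJ b J (negIdx P i) ↔ InJ b J i := by simp [InJ]

lemma ofIdx_mem_fixModJ {i : ι} (hi : InJ b J i) : weylGroup.ofIdx P i ∈ fixModJ b J := fun m ↦ by
  rw [ofIdx_smul_weight, reflection_apply, sub_sub_cancel_left]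
  exact neg_mem (Submodule.smul_mem _ _ hi)

lemma parabolic_le_fixModJ : parabolic b J ≤ fixModJ b J :=
  (Subgroup.closure_le _).2 <| by
    rintro - ⟨j, hj, rfl⟩
    exact ofIdx_mem_fixModJ (inJ_simple hj)

lemma inJ_smul {x : P.weylGroup} (hx : x ∈ fixModJ b J) {i : ι} : InJ b J (x • i) ↔ InJ b J i := by
  rw [InJ, InJ, root_smul, ← Submodule.sub_mem_iff_left _ (hx (P.root i)), sub_sub_cancel]

variable [P.IsRootSystem]

lemma inJ_iff {i : ι} : InJ b J i ↔ ∀ k ∉ J, b.toWeightBasis.repr (P.root i) k = 0 := by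
  have : (fun j : b.support ↦ P.root j) = b.toWeightBasis := by ext; simp
  rw [InJ, spanJ, this, Module.Basis.mem_span_image, Set.subset_def]
  refine forall_congr' fun k ↦ ?_
  rw [Finset.mem_coe, Finsupp.mem_support_iff]
  tauto

lemma inJ_simple_iff {k : b.support} : InJ b J k ↔ k ∈ J := by
  refine ⟨fun h ↦ ?_, inJ_simple⟩
  by_contra hk
  simpa using inJ_iff.1 h k hk

variable [Finite ι] [P.IsCrystallographic]

lemma repr_root_nonneg {i : ι} (hi : b.IsPos i) (k : b.support) :
    0 ≤ b.toWeightBasis.repr (P.root i) k := by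
  classical
  have hs (j : ι) (hj : j ∈ b.support) : 0 ≤ b.toWeightBasis.repr (P.root j) k := by
    rw [b.toWeightBasis_repr_root ⟨j, hj⟩, Finsupp.single_apply]
    split_ifs <;> simp
  refine hi.induction_on_add (p := fun i ↦ 0 ≤ b.toWeightBasis.repr (P.root i) k) hs ?_
  intro i j l hl h₁ hj
  rw [hl, map_add, Finsupp.add_apply]
  exact add_nonneg h₁ (hs j hj)

lemma isPos_of_repr_root_pos {i : ι} {k : b.support} (h : 0 < b.toWeightBasis.repr (P.root i) k) :
    b.IsPos i := by
  by_contra hi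
  have := repr_root_nonneg (isPos_negIdx.2 hi) k
  rw [root_negIdx, map_neg, Finsupp.neg_apply] at this
  linarith

/-- Positivity of a root outside `Φ_J` is read off from a coefficient outside `J`, and such
coefficients do not change under `W_J`. -/
lemma isPos_smul_of_not_inJ {x : P.weylGroup} (hx : x ∈ fixModJ b J) {i : ι} (hi : b.IsPos i)
    (hiJ : ¬ InJ b J i) : b.IsPos (x • i) := by
  rw [inJ_iff] at hiJ
  push Not at hiJ
  obtain ⟨k, hk, hne⟩ := hiJ
  have hdiff : b.toWeightBasis.repr (x • P.root i - P.root i) k = 0 := by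
    have h := hx (P.root i)
    have : (fun j : b.support ↦ P.root j) = b.toWeightBasis := by ext; simp
    rw [spanJ, this, Module.Basis.mem_span_image] at h
    exact Finsupp.notMem_support_iff.1 fun h' ↦ hk (h h')
  rw [map_sub, Finsupp.sub_apply, sub_eq_zero] at hdiff
  refine isPos_of_repr_root_pos (k := k) ?_
  rw [root_smul, hdiff]
  exact (repr_root_nonneg hi k).lt_of_ne hne.symm

lemma isPos_smul_iff_of_not_inJ {x : P.weylGroup} (hx : x ∈ fixModJ b J) {i : ι}
    (hiJ : ¬ InJ b J i) : b.IsPos (x • i) ↔ b.IsPos i := by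
  refine ⟨fun h ↦ ?_, fun h ↦ isPos_smul_of_not_inJ hx h hiJ⟩
  simpa using isPos_smul_of_not_inJ (inv_mem hx) h (by rwa [inJ_smul hx])

/-- The positive roots of `Φ_J` are the nonnegative combinations of the `α_j`, `j ∈ J`, so that an
element of `W` keeps them positive as soon as it does so for the `α_j`. -/
lemma isPos_smul_of_inJ {u : P.weylGroup} (hu : ∀ j ∈ J, b.IsPos (u • (j : ι))) {i : ι}
    (hi : b.IsPos i) (hiJ : InJ b J i) : b.IsPos (u • i) := by
  classical
  have hsum : P.root i = ∑ k, b.toWeightBasis.repr (P.root i) k • P.root k := by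
    simpa using (b.toWeightBasis.sum_repr (P.root i)).symm
  by_contra hneg
  have hle (l : b.support) : b.toWeightBasis.repr (P.root (u • i)) l ≤ 0 := by
    by_contra! h
    exact hneg (isPos_of_repr_root_pos h)
  have hge (l : b.support) : 0 ≤ b.toWeightBasis.repr (P.root (u • i)) l := by
    have h2 : P.root (u • i) = ∑ k, b.toWeightBasis.repr (P.root i) k • P.root (u • (k : ι)) := by
      conv_lhs => rw [root_smul, hsum, Finset.smul_sum]
      exact Finset.sum_congr rfl fun k _ ↦ by
        rw [root_smul, Subgroup.smul_def, Subgroup.smul_def, smul_comm]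
    rw [h2, map_sum, Finsupp.finsetSum_apply]
    refine Finset.sum_nonneg fun k _ ↦ ?_
    rw [map_smul, Finsupp.smul_apply, smul_eq_mul]
    by_cases hk : k ∈ J
    · exact mul_nonneg (repr_root_nonneg hi k) (repr_root_nonneg (hu k hk) l)
    · rw [inJ_iff.1 hiJ k hk, zero_mul]
  refine P.ne_zero (u • i) (b.toWeightBasis.repr.map_eq_zero_iff.1 ?_)
  ext l
  exact (hle l).antisymm (hge l)

variable [P.IsReduced]

lemma eq_one_of_mem_fixModJ {x : P.weylGroup} (hx : x ∈ fixModJ b J)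
    (hpos : ∀ j ∈ J, b.IsPos (x • (j : ι))) : x = 1 :=
  eq_one_of_forall_isPos b fun k ↦ by
    by_cases hk : k ∈ J
    · exact hpos k hk
    · exact isPos_smul_of_not_inJ hx (Base.isPos_of_mem_support k.2) (by rwa [inJ_simple_iff])

omit [P.IsRootSystem] in
lemma isPos_smul_of_mem_minReps {u : P.weylGroup} (hu : u ∈ minReps b J) {j : b.support}
    (hj : j ∈ J) : b.IsPos (u • (j : ι)) := by
  by_contra h
  exact (length_mul_simpleW_lt b j h).not_ge (hu _ (Subgroup.subset_closure ⟨j, hj, rfl⟩))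

/-- Two elements of the same coset modulo `W_J` that both keep the `α_j`, `j ∈ J`, positive
coincide. -/
lemma eq_one_of_mul_isPos {u x : P.weylGroup} (hx : x ∈ fixModJ b J)
    (hu : ∀ j ∈ J, b.IsPos (u • (j : ι))) (hux : ∀ j ∈ J, b.IsPos ((u * x) • (j : ι))) : x = 1 := by
  refine eq_one_of_mem_fixModJ hx fun j hj ↦ ?_
  by_contra hneg
  have h := isPos_smul_of_inJ hu (isPos_negIdx.2 hneg)
    (inJ_negIdx.2 ((inJ_smul hx).2 (inJ_simple hj)))
  rw [smul_negIdx, ← mul_smul, isPos_negIdx] at h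
  exact h (hux j hj)

lemma mem_minReps_iff {u : P.weylGroup} :
    u ∈ minReps b J ↔ ∀ j ∈ J, b.IsPos (u • (j : ι)) := by
  refine ⟨fun h j hj ↦ isPos_smul_of_mem_minReps h hj, fun h ↦ ?_⟩
  obtain ⟨u', v, hv, rfl⟩ := exists_minRep b J u
  rw [eq_one_of_mul_isPos (parabolic_le_fixModJ hv)
    (fun j hj ↦ isPos_smul_of_mem_minReps u'.2 hj) h, mul_one]
  exact u'.2

omit [P.IsRootSystem] [Finite ι] [P.IsCrystallographic] [P.IsReduced] in
variable (b J) in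
lemma exists_eq_minRep_mul (x : P.weylGroup) : ∃ v ∈ parabolic b J, x = minRep b J x * v :=
  (exists_minRep b J x).choose_spec

/-- `x^J` depends only on the coset `x W_J`. -/
lemma minRep_eq_of_mul {u : minReps b J} {x v : P.weylGroup} (hv : v ∈ fixModJ b J)
    (hx : x = u * v) : minRep b J x = u := by
  obtain ⟨v', hv', hx'⟩ := exists_eq_minRep_mul b J x
  have h : (u : P.weylGroup) * (v * v'⁻¹) = minRep b J x := by
    rw [← mul_assoc, ← hx, mul_inv_eq_iff_eq_mul, ← hx']
  have hmem : v * v'⁻¹ ∈ fixModJ b J := mul_mem hv (inv_mem (parabolic_le_fixModJ hv'))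
  have h1 : v * v'⁻¹ = 1 := by
    refine eq_one_of_mul_isPos hmem (fun j hj ↦ isPos_smul_of_mem_minReps u.2 hj) fun j hj ↦ ?_
    rw [h]
    exact isPos_smul_of_mem_minReps (minRep b J x).2 hj
  rw [h1, mul_one] at h
  exact Subtype.ext h.symm

lemma minRep_mul {x v : P.weylGroup} (hv : v ∈ fixModJ b J) :
    minRep b J (x * v) = minRep b J x := by
  obtain ⟨v', hv', hx'⟩ := exists_eq_minRep_mul b J x
  refine minRep_eq_of_mul (mul_mem (parabolic_le_fixModJ hv') hv) ?_
  rw [← mul_assoc, ← hx']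

lemma minRep_coe (u : minReps b J) : minRep b J u = u :=
  minRep_eq_of_mul (one_mem _) (mul_one _).symm

omit [P.IsRootSystem] [Finite ι] [P.IsCrystallographic] [P.IsReduced] in
lemma length_minRep_le (x : P.weylGroup) : length b (minRep b J x) ≤ length b x := by
  obtain ⟨v, hv, hx⟩ := exists_eq_minRep_mul b J x
  conv_rhs => rw [hx]
  exact (minRep b J x).2 v hv

end Cosets

/-! ### The highest root and the marks -/

section Highest

variable {ι M N : Type*} [AddCommGroup M] [Module ℝ M] [AddCommGroup N] [Module ℝ N]
  {P : RootPairing ι ℝ M N} (b : P.Base)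

section HighestRoot

variable [Finite ι] [Nonempty ι]

lemma isPos_highestRoot : b.IsPos (highestRoot b) := by
  obtain ⟨i⟩ := ‹Nonempty ι›
  by_cases hi : b.IsPos i
  · exact hi.trans_le (height_le_highestRoot b i)
  · exact lt_of_lt_of_le (isPos_negIdx.2 hi) (height_le_highestRoot b (negIdx P i))

variable [P.IsCrystallographic]

variable {b}

/-- Otherwise `α + θ` would be a root higher than `θ`. -/
lemma pairingIn_highestRoot_nonneg {i : ι} (hi : b.IsPos i) :
    0 ≤ P.pairingIn ℤ i (highestRoot b) := by
  by_contra! h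
  have hpos := isPos_highestRoot b
  obtain ⟨k, hk⟩ := P.root_add_root_mem_of_pairingIn_neg h fun h' ↦ by
    rw [← root_negIdx, P.root.injective.eq_iff] at h'
    exact isPos_negIdx.1 (h' ▸ hi) hpos
  have h1 := b.height_add hk
  have h2 := height_le_highestRoot b k
  rw [Base.isPos_iff] at hi
  omega

/-- If `α ≠ θ` is positive and `m = ⟨α, θ^∨⟩ ≥ 2`, then `α - θ` is a root, so that `α` is lower than
`θ`, and `m θ - α` is a root higher than `θ`. -/
lemma pairingIn_highestRoot_le_one {i : ι} (hi : i ≠ highestRoot b) :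
    P.pairingIn ℤ i (highestRoot b) ≤ 1 := by
  by_contra! h
  obtain ⟨k, hk⟩ := P.root_sub_root_mem_of_pairingIn_pos (by omega) hi
  have h1 := b.height_sub hk
  have h2 := b.height_ne_zero k
  have h3 := height_le_highestRoot b i
  have h4 : P.root (negIdx P (weylGroup.ofIdx P (highestRoot b) • i)) =
      P.root (negIdx P i) + P.pairingIn ℤ i (highestRoot b) • P.root (highestRoot b) := by
    rw [root_negIdx, root_negIdx, root_smul, ofIdx_smul_weight, reflection_apply_root' ℤ]
    abel
  have h5 := b.height_add_zsmul h4
  have h6 : b.height (negIdx P i) = -b.height i := b.height_reflectionPerm_self i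
  have h7 := height_le_highestRoot b (negIdx P (weylGroup.ofIdx P (highestRoot b) • i))
  have h8 := isPos_highestRoot b
  rw [Base.isPos_iff] at h8
  rw [h5, h6, smul_eq_mul] at h7
  have h9 : b.height i < b.height (highestRoot b) := by omega
  nlinarith

lemma not_isPos_highestRoot_smul {i : ι} (hi : P.pairingIn ℤ i (highestRoot b) = 1) :
    ¬ b.IsPos (weylGroup.ofIdx P (highestRoot b) • i) := by
  have h : P.root (weylGroup.ofIdx P (highestRoot b) • i) = P.root i - P.root (highestRoot b) := by
    rw [root_smul, ofIdx_smul_weight, reflection_apply_root' ℤ, hi, one_smul]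
  rw [Base.isPos_iff, b.height_sub h, not_lt, sub_nonpos]
  exact height_le_highestRoot b i

lemma highestRoot_smul_eq_self {i : ι} (hi : P.pairingIn ℤ i (highestRoot b) = 0) :
    weylGroup.ofIdx P (highestRoot b) • i = i := by
  apply P.root.injective
  rw [root_smul, ofIdx_smul_weight, reflection_apply_root' ℤ, hi, zero_smul, sub_zero]

variable [P.IsRootSystem] [P.IsReduced] [P.IsIrreducible]

lemma repr_highestRoot_ne_zero (k : b.support) :
    b.toWeightBasis.repr (P.root (highestRoot b)) k ≠ 0 := by
  classical
  set c := b.toWeightBasis.repr (P.root (highestRoot b)) with hc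
  have hc0 (j) : 0 ≤ c j := repr_root_nonneg (isPos_highestRoot b) j
  let T : Set b.support := {j | c j ≠ 0}
  have hT : InJ b T (highestRoot b) := inJ_iff.2 fun j hj ↦ by simpa [T] using hj
  -- A simple root outside the support of `θ` is orthogonal to that support, since its pairing
  -- with `θ` is nonnegative.
  have horth (l : b.support) (hl : l ∉ T) (j : b.support) (hj : j ∈ T) : P.pairing j l = 0 := by
    have hsum : P.pairing (highestRoot b) l = ∑ j, c j * P.pairing j l := by
      have h := congrArg (P.coroot' l) (b.toWeightBasis.sum_repr (P.root (highestRoot b)))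
      simpa [map_sum] using h.symm
    have hle (j : b.support) : c j * P.pairing j l ≤ 0 := by
      by_cases hjl : j = l
      · have : c l = 0 := by simpa [T] using hl
        simp [hjl, this]
      · have h := b.pairingIn_le_zero_of_ne (i := j) (j := l) (fun h ↦ hjl (Subtype.ext h))
          j.2 l.2
        refine mul_nonpos_of_nonneg_of_nonpos (hc0 j) ?_
        rw [← P.algebraMap_pairingIn ℤ, eq_intCast]
        exact_mod_cast h
    have hge : 0 ≤ P.pairing (highestRoot b) l := by
      have h := pairingIn_highestRoot_nonneg (b := b) (Base.isPos_of_mem_support l.2)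
      have h' : 0 ≤ P.pairingIn ℤ (highestRoot b) l := by
        by_contra! h1
        have h2 := (P.pairingIn_lt_zero_iff (S := ℤ)).1 h1
        omega
      rw [← P.algebraMap_pairingIn ℤ, eq_intCast]
      exact_mod_cast h'
    have hz := (Finset.sum_eq_zero_iff_of_nonpos fun j _ ↦ hle j).1
      (le_antisymm (Finset.sum_nonpos fun j _ ↦ hle j) (hsum ▸ hge)) j (Finset.mem_univ j)
    exact (mul_eq_zero.1 hz).resolve_left hj
  have hinv (i : ι) : spanJ b T ∈ Module.End.invtSubmodule (P.reflection i) := by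
    refine (b.forall_mem_support_invtSubmodule_iff (spanJ b T)).1 (fun l hl ↦ ?_) i
    by_cases hlT : (⟨l, hl⟩ : b.support) ∈ T
    · exact Submodule.mem_invtSubmodule_reflection_of_mem _ _ (inJ_simple hlT)
    · rw [Module.End.mem_invtSubmodule, spanJ, Submodule.span_le]
      rintro - ⟨j, hj, rfl⟩
      have h0 := horth ⟨l, hl⟩ hlT j hj
      simp only [Submodule.comap_coe, Set.mem_preimage, LinearEquiv.coe_coe, SetLike.mem_coe]
      rw [reflection_apply_root, h0, zero_smul, sub_zero]
      exact Submodule.subset_span ⟨j, hj, rfl⟩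
  have htop : spanJ b T = ⊤ := by
    refine IsIrreducible.eq_top_of_invtSubmodule_reflection _ hinv fun h0 ↦ ?_
    rw [InJ, h0, Submodule.mem_bot] at hT
    exact P.ne_zero _ hT
  have hk : InJ b T k := by
    rw [InJ, htop]
    exact Submodule.mem_top
  exact inJ_simple_iff.1 hk

lemma mark_ne_zero (i : Option b.support) : mark b i ≠ 0 := by
  cases i with
  | none => simp [mark]
  | some k =>
    intro h
    refine repr_highestRoot_ne_zero (b := b) k ?_
    have h1 := congrArg (Submodule.subtype _)
      (b.toWeightBasisInt.sum_repr (P.rootSpanMem ℤ (highestRoot b)))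
    have h2 : P.root (highestRoot b) =
        ∑ j, b.toWeightBasisInt.repr (P.rootSpanMem ℤ (highestRoot b)) j • P.root j := by
      simpa [map_sum] using h1.symm
    have h3 : P.root (highestRoot b) = ∑ j,
        (b.toWeightBasisInt.repr (P.rootSpanMem ℤ (highestRoot b)) j : ℝ) • b.toWeightBasis j := by
      rw [h2]
      exact Finset.sum_congr rfl fun j _ ↦ by
        rw [Base.toWeightBasis_apply, Int.cast_smul_eq_zsmul]
    rw [h3, b.toWeightBasis.repr_sum_self]
    rw [mark] at h
    rw [h, Int.cast_zero]

end HighestRoot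

end Highest

/-! ### The arrows of the graph -/

section Arrows

variable {ι M N : Type*} [AddCommGroup M] [Module ℝ M] [AddCommGroup N] [Module ℝ N]
  {P : RootPairing ι ℝ M N} {b : P.Base} {J : Set b.support}

/-- The action of `u ∈ W` on the coroot lattice. -/
def rightQ (q : P.corootSpan ℤ) (u : P.weylGroup) : P.corootSpan ℤ :=
  ⟨rightW (q : N) u, rightW_mem _ q.2 u⟩

lemma rightQ_one (q : P.corootSpan ℤ) : rightQ q 1 = q := Subtype.ext (rightW_one _)

lemma rightQ_mul (q : P.corootSpan ℤ) (u v : P.weylGroup) :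
    rightQ q (u * v) = rightQ (rightQ q u) v := Subtype.ext (rightW_mul _ _ _)

lemma mul_wt (w w' : AffineWeyl P) : (w * w').wt = rightQ w.wt w'.f + w'.wt := rfl

lemma mul_ofW_wt (w : AffineWeyl P) (u : P.weylGroup) : (w * ofW u).wt = rightQ w.wt u := by
  rw [mul_wt]
  exact add_zero _

lemma rightW_ofIdx (x : N) (i : ι) :
    rightW x (weylGroup.ofIdx P i) = x - P.root' i x • P.coroot i :=
  (P.coreflection_apply i x : P.coreflection i x = _)

lemma cls_add (q q' : P.corootSpan ℤ) : cls b J (q + q') = cls b J q + cls b J q' := map_add _ _ _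

lemma cls_sub (q q' : P.corootSpan ℤ) : cls b J (q - q') = cls b J q - cls b J q' := map_sub _ _ _

lemma cls_rightQ [P.IsCrystallographic] {x : P.weylGroup} (hx : x ∈ parabolic b J)
    (q : P.corootSpan ℤ) : cls b J (rightQ q x) = cls b J q := by
  induction hx using Subgroup.closure_induction generalizing q with
  | mem x hx =>
    obtain ⟨j, hj, rfl⟩ := hx
    refine (Submodule.Quotient.eq _).2 ?_
    have h : rightQ q (simpleW b j) - q = -(P.root'In ℤ j q • P.corootSpanMem ℤ j) := by
      apply Subtype.ext
      have h1 : P.root' j (q : N) = (P.root'In ℤ j q : ℝ) := (P.algebraMap_root'In_apply ℤ j q).symm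
      have h2 : rightW (q : N) (simpleW b j) = q - (P.root'In ℤ j q : ℝ) • P.coroot j := by
        rw [simpleW, rightW_ofIdx, h1]
      change rightW (q : N) (simpleW b j) - q = -(P.root'In ℤ j q • P.coroot j)
      rw [h2, Int.cast_smul_eq_zsmul]
      abel
    rw [h]
    exact neg_mem (Submodule.smul_mem _ _ (Submodule.subset_span ⟨j, hj, rfl⟩))
  | one => rw [rightQ_one]
  | mul x y _ _ hx hy => rw [rightQ_mul, hy, hx]
  | inv x _ hx => rw [← hx (rightQ q x⁻¹), ← rightQ_mul, inv_mul_cancel, rightQ_one]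

/-- If `u⁻¹ α ∈ Φ_J`, then `s_α u` lies in the coset `u W_J`. -/
lemma conj_mem_fixModJ {u : P.weylGroup} {i : ι} (h : InJ b J (u⁻¹ • i)) :
    u⁻¹ * (weylGroup.ofIdx P i * u) ∈ fixModJ b J := fun m ↦ by
  have h' : (u⁻¹ * (weylGroup.ofIdx P i * u)) • m - m =
      -(P.coroot' i (u • m) • P.root (u⁻¹ • i)) := by
    rw [mul_smul, mul_smul, ofIdx_smul_weight, reflection_apply, smul_sub, inv_smul_smul,
      root_smul, sub_sub_cancel_left, Subgroup.smul_def, Subgroup.smul_def, smul_comm]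
    rfl
  rw [h']
  exact neg_mem (Submodule.smul_mem _ _ h)

section

variable [Finite ι] [Nonempty ι]

variable (b) in
/-- The finite part of the affine simple root: the index of `α_i` for `i ∈ I^*`, and that of `-θ` for
the index `0`. -/
def affRoot : Option b.support → ι
  | some i => i
  | none => negIdx P (highestRoot b)

lemma simpleA_f (i : Option b.support) : (simpleA b i).f = weylGroup.ofIdx P (affRoot b i) := by
  cases i with
  | some i => rfl
  | none => exact (ofIdx_negIdx _).symm

lemma simpleA_mul_self (i : Option b.support) : simpleA b i * simpleA b i = 1 := by
  refine AffineWeyl.ext ?_ (Subtype.ext ?_)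
  · rw [mul_f, simpleA_f, ofIdx_mul_self]
    rfl
  · cases i with
    | some i => exact (congrArg (· + (0 : N)) (smul_zero _)).trans (add_zero _)
    | none =>
      rw [coe_mul_wt]
      change rightW (P.coroot _) (weylGroup.ofIdx P _) + P.coroot _ = 0
      rw [rightW_ofIdx, root', root_coroot_eq_pairing, pairing_same]
      module

lemma simpleA_mul_simpleA_mul (i : Option b.support) (w : AffineWeyl P) :
    simpleA b i * (simpleA b i * w) = w := by
  rw [← mul_assoc, simpleA_mul_self, one_mul]

lemma inv_smul_simpleA_mul (i : Option b.support) (w : AffineWeyl P) :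
    (simpleA b i * w).f⁻¹ • affRoot b i = negIdx P (w.f⁻¹ • affRoot b i) := by
  rw [mul_f, simpleA_f, inv_smul_ofIdx]

variable [P.IsRootSystem] [P.IsCrystallographic] [P.IsReduced]

omit [Nonempty ι] in
/-- With `v = (s_α u)^J`, the element `v⁻¹` makes `α` negative, since `W_J` keeps the positive root
`u⁻¹ α ∉ Φ_J` positive. So `s_α v` is shorter than `v`, and it lies in `u W_J`. -/
lemma length_lt_minRep {u : minReps b J} {i : ι} (hi : b.IsPos i)
    (hpos : b.IsPos ((u : P.weylGroup)⁻¹ • i)) (hJ : ¬ InJ b J ((u : P.weylGroup)⁻¹ • i)) :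
    length b u < length b (minRep b J (weylGroup.ofIdx P i * u)) := by
  set v := minRep b J (weylGroup.ofIdx P i * u)
  obtain ⟨x, hx, hvx⟩ := exists_eq_minRep_mul b J (weylGroup.ofIdx P i * u)
  change _ = (v : P.weylGroup) * x at hvx
  have hx' := parabolic_le_fixModJ hx
  have hv : (v : P.weylGroup) = weylGroup.ofIdx P i * u * x⁻¹ := by rw [hvx, mul_inv_cancel_right]
  have h1 : (v : P.weylGroup)⁻¹ • i = negIdx P (x • (u : P.weylGroup)⁻¹ • i) := by
    rw [hv, mul_inv_rev, inv_inv, mul_smul, inv_smul_ofIdx, smul_negIdx]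
  have h2 := length_ofIdx_mul_lt b (u := v) hi (by
    rw [h1, isPos_negIdx, not_not]
    exact isPos_smul_of_not_inJ hx' hpos hJ)
  have h3 : minRep b J (weylGroup.ofIdx P i * v) = u := by
    refine minRep_eq_of_mul (inv_mem hx') ?_
    rw [hv, ← mul_assoc, ← mul_assoc, ofIdx_mul_self, one_mul]
  have h4 := length_minRep_le (b := b) (J := J) (weylGroup.ofIdx P i * v)
  rw [h3] at h4
  exact h4.trans_lt h2

/-- There is an arrow of type `i` from `u` exactly when `u⁻¹` sends the finite part of the affine
simple root `α_i` to a positive root outside `Φ_J`, and it goes to `f(s_i u)^J`. -/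
lemma arrow_iff (i : Option b.support) (c : WeightRing b J) (u v : minReps b J) :
    Arrow b J i c u v ↔
      c = monomial b J (mark b i) (simpleA b i * ofW (u : P.weylGroup)).wt ∧
      v = minRep b J (simpleA b i * ofW (u : P.weylGroup)).f ∧
      b.IsPos ((u : P.weylGroup)⁻¹ • affRoot b i) ∧
      ¬ InJ b J ((u : P.weylGroup)⁻¹ • affRoot b i) := by
  have hwt (k : b.support) (u : P.weylGroup) : (simpleA b (some k) * ofW u).wt = 0 := by
    rw [mul_ofW_wt]
    exact Subtype.ext (smul_zero _)
  constructor
  · intro h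
    cases h with
    | finite k u hmem hlen =>
      have hpos : b.IsPos ((u : P.weylGroup)⁻¹ • (k : ι)) := by
        by_contra hneg
        have := length_ofIdx_mul_lt b (Base.isPos_of_mem_support k.2) hneg
        rw [← simpleW, hlen] at this
        omega
      refine ⟨by rw [hwt], (minRep_coe ⟨_, hmem⟩).symm, hpos, fun hJ ↦ ?_⟩
      have h := isPos_smul_of_inJ (fun j hj ↦ isPos_smul_of_mem_minReps hmem hj) hpos hJ
      rw [mul_smul, smul_inv_smul, simpleW, ofIdx_smul_self, isPos_negIdx] at h
      exact h (Base.isPos_of_mem_support k.2)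
    | zero u hlen =>
      have hJ : ¬ InJ b J ((u : P.weylGroup)⁻¹ • affRoot b none) := fun hJ ↦ by
        have h : minRep b J (simpleA b none * ofW (u : P.weylGroup)).f = u :=
          minRep_eq_of_mul (conj_mem_fixModJ hJ) (by
            rw [mul_inv_cancel_left, mul_f, simpleA_f]; rfl)
        rw [h] at hlen
        exact lt_irrefl _ hlen
      refine ⟨rfl, rfl, ?_, hJ⟩
      by_contra hneg
      rw [affRoot, smul_negIdx] at hneg hJ
      rw [isPos_negIdx, not_not] at hneg
      exact hlen.not_gt (length_lt_minRep (isPos_highestRoot b) hneg (by rwa [← inJ_negIdx]))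
  · rintro ⟨rfl, rfl, hpos, hJ⟩
    cases i with
    | some k =>
      have hmem : simpleW b k * (u : P.weylGroup) ∈ minReps b J := mem_minReps_iff.2 fun j hj ↦ by
        rw [mul_smul]
        refine isPos_simpleW_smul k (isPos_smul_of_mem_minReps u.2 hj) fun h ↦ hJ ?_
        rw [affRoot, ← h, inv_smul_smul]
        exact inJ_simple hj
      have hlen : length b (simpleW b k * u) = length b u + 1 :=
        le_antisymm (length_simpleW_mul_le b k u)
          (length_lt_ofIdx_mul b (Base.isPos_of_mem_support k.2) hpos)
      have h := Arrow.finite k u hmem hlen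
      rw [← minRep_coe ⟨_, hmem⟩, ← hwt k u] at h
      exact h
    | none =>
      refine Arrow.zero u ((length_minRep_le _).trans_lt ?_)
      refine length_ofIdx_mul_lt b (isPos_highestRoot b) ?_
      rwa [affRoot, smul_negIdx, isPos_negIdx] at hpos

/-- The description of the arrows from `u^J` in terms of `u`. -/
lemma arrow_minRep_iff (i : Option b.support) (c : WeightRing b J) (u : P.weylGroup)
    (v : minReps b J) :
    Arrow b J i c (minRep b J u) v ↔
      c = monomial b J (mark b i) (rightQ (simpleA b i).wt u) ∧
      v = minRep b J ((simpleA b i).f * u) ∧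
      b.IsPos (u⁻¹ • affRoot b i) ∧ ¬ InJ b J (u⁻¹ • affRoot b i) := by
  obtain ⟨x, hx, hux⟩ := exists_eq_minRep_mul b J u
  have hx' := parabolic_le_fixModJ hx
  set u' := minRep b J u
  have hroot : u⁻¹ • affRoot b i = x⁻¹ • (u' : P.weylGroup)⁻¹ • affRoot b i := by
    rw [hux, mul_inv_rev, mul_smul]
  have hwt : monomial b J (mark b i) (rightQ (simpleA b i).wt u) =
      monomial b J (mark b i) (rightQ (simpleA b i).wt u') := by
    rw [monomial, monomial, hux, rightQ_mul, cls_rightQ hx]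
  have hmin : minRep b J ((simpleA b i).f * u) = minRep b J ((simpleA b i).f * u') := by
    rw [hux, ← mul_assoc, minRep_mul hx']
  rw [arrow_iff, mul_ofW_wt, mul_f, hwt, hmin, hroot, inJ_smul (inv_mem hx')]
  refine and_congr_right' (and_congr_right' (and_congr_left fun hJ ↦ ?_))
  exact (isPos_smul_iff_of_not_inJ (inv_mem hx') hJ).symm

end

end Arrows

/-! ### Alcoves and hyperplanes -/

section Alcoves

variable {ι M N : Type*} [AddCommGroup M] [Module ℝ M] [AddCommGroup N] [Module ℝ N]
  {P : RootPairing ι ℝ M N} {b : P.Base} {J : Set b.support}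

lemma root'_rightW (x : N) (u : P.weylGroup) (j : ι) :
    P.root' j (rightW x u) = P.root' (u • j) x := by
  have h := LinearMap.congr_fun
    (Hom.weight_coweight_transpose_apply P P x (u : P.Aut).toHom) (P.root j)
  have h' : P.root (u • j) = (u : P.Aut).toHom.weightMap (P.root j) := root_smul u j
  rw [root', root', h']
  exact h.symm

lemma root'_negIdx (j : ι) (x : N) : P.root' (negIdx P j) x = -P.root' j x := by
  rw [root', root_negIdx, map_neg]
  rfl

variable (b) in
open Classical in
/-- The indicator of the negative roots, with values in `ℤ`. -/
def negInd (i : ι) : ℤ := if b.IsPos i then 0 else 1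

lemma negInd_of_isPos {i : ι} (h : b.IsPos i) : negInd b i = 0 := if_pos h

lemma negInd_of_not_isPos {i : ι} (h : ¬ b.IsPos i) : negInd b i = 1 := if_neg h

lemma negInd_negIdx (i : ι) : negInd b (negIdx P i) = 1 - negInd b i := by
  by_cases h : b.IsPos i
  · rw [negInd_of_isPos h, negInd_of_not_isPos (by rwa [isPos_negIdx, not_not]), sub_zero]
  · rw [negInd_of_not_isPos h, negInd_of_isPos (isPos_negIdx.2 h), sub_self]

section Crystallographic

variable [P.IsCrystallographic]

variable (b) in
/-- The integer `m` for which the alcove `w` lies in the strip `m < (x, α_j) < m + 1`, where `α_j` is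
the root of index `j`; see `mem_strip_of_mem_alcove`. -/
def level (w : AffineWeyl P) (j : ι) : ℤ := P.root'In ℤ j w.wt - negInd b (w.f • j)

lemma root'In_cast (j : ι) (q : P.corootSpan ℤ) : (P.root'In ℤ j q : ℝ) = P.root' j q :=
  P.algebraMap_root'In_apply ℤ j q

lemma root'In_negIdx (j : ι) (q : P.corootSpan ℤ) :
    P.root'In ℤ (negIdx P j) q = -P.root'In ℤ j q := by
  have : (P.root'In ℤ (negIdx P j) q : ℝ) = -P.root'In ℤ j q := by
    rw [root'In_cast, root'In_cast, root'_negIdx]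
  exact_mod_cast this

lemma root'In_rightQ (j : ι) (q : P.corootSpan ℤ) (u : P.weylGroup) :
    P.root'In ℤ j (rightQ q u) = P.root'In ℤ (u • j) q := by
  have : (P.root'In ℤ j (rightQ q u) : ℝ) = P.root'In ℤ (u • j) q := by
    rw [root'In_cast, root'In_cast]
    exact root'_rightW _ _ _
  exact_mod_cast this

/-- Opposite roots have levels summing to `-1`. -/
lemma level_negIdx (w : AffineWeyl P) (j : ι) : level b w (negIdx P j) = -1 - level b w j := by
  rw [level, level, root'In_negIdx, smul_negIdx, negInd_negIdx]
  ring

lemma level_mul (w w' : AffineWeyl P) (j : ι) :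
    level b (w * w') j = level b w (w'.f • j) + negInd b (w'.f • j) + level b w' j := by
  rw [level, level, level, mul_wt, map_add, root'In_rightQ, mul_f, mul_smul]
  ring

lemma mem_strip_of_mem_alcove {w : AffineWeyl P} {x : N} (hx : x ∈ alcove b w) (j : ι) :
    (level b w j : ℝ) < P.root' j x ∧ P.root' j x < level b w j + 1 := by
  obtain ⟨y, hy, rfl⟩ := hx
  have h : P.root' j (act y w) = P.root' (w.f • j) y + P.root'In ℤ j w.wt := by
    rw [act, map_add, root'_rightW, root'In_cast]
  simp only [h, level, Int.cast_sub]
  by_cases hpos : b.IsPos (w.f • j)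
  · have := hy _ hpos
    rw [negInd_of_isPos hpos, Int.cast_zero]
    constructor <;> linarith
  · have := hy _ (isPos_negIdx.2 hpos)
    rw [root'_negIdx] at this
    rw [negInd_of_not_isPos hpos, Int.cast_one]
    constructor <;> linarith

variable [Finite ι] [Nonempty ι] [P.IsRootSystem]

variable (b) in
/-- A small positive multiple of the sum of the fundamental coweights lies in `A_0`. -/
lemma fundAlcove_nonempty : (fundAlcove b).Nonempty := by
  let f : Module.Dual ℝ M := ∑ k, b.toWeightBasis.coord k
  have hf (i : ι) (hi : b.IsPos i) : f (P.root i) = b.height i := by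
    have hs (j : ι) (hj : j ∈ b.support) : f (P.root j) = b.height j := by
      classical
      rw [Base.height_one_of_mem_support hj]
      simp only [f, LinearMap.sum_apply, Module.Basis.coord_apply]
      rw [b.toWeightBasis_repr_root ⟨j, hj⟩]
      simp [Finsupp.single_apply]
    refine hi.induction_on_add (p := fun i ↦ f (P.root i) = b.height i) hs ?_
    intro i j k hk hi hj
    rw [hk, map_add, hi, hs j hj, b.height_add hk, Int.cast_add]
  set m : ℝ := (b.height (highestRoot b) : ℝ)
  have hm : 0 < m := Int.cast_pos.2 ((b.isPos_iff).1 (isPos_highestRoot b))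
  refine ⟨(m + 1)⁻¹ • P.flip.toPerfPair.symm f, fun i hi ↦ ?_⟩
  have h : P.root' i (P.flip.toPerfPair.symm f) = b.height i := by
    rw [← hf i hi]
    exact LinearMap.congr_fun (P.flip.toPerfPair.apply_symm_apply f) (P.root i)
  have h1 : (0 : ℝ) < b.height i := Int.cast_pos.2 hi
  have h2 : (b.height i : ℝ) ≤ m := Int.cast_le.2 (height_le_highestRoot b i)
  rw [map_smul, h, smul_eq_mul, inv_mul_eq_div]
  exact ⟨by positivity, by rw [div_lt_one (by linarith)]; linarith⟩

lemma alcove_nonempty (w : AffineWeyl P) : (alcove b w).Nonempty :=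
  (fundAlcove_nonempty b).image _

lemma alcove_subset_negSide_iff {w : AffineWeyl P} {j : ι} {k : ℤ} :
    alcove b w ⊆ negSide P j k ↔ level b w j < k := by
  refine ⟨fun h ↦ ?_, fun h x hx ↦ ?_⟩
  · obtain ⟨x, hx⟩ := alcove_nonempty (b := b) w
    exact_mod_cast (mem_strip_of_mem_alcove hx j).1.trans (h hx)
  · refine (mem_strip_of_mem_alcove hx j).2.trans_le ?_
    exact_mod_cast h

lemma alcove_subset_posSide_iff {w : AffineWeyl P} {j : ι} {k : ℤ} :
    alcove b w ⊆ posSide P j k ↔ k ≤ level b w j := by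
  refine ⟨fun h ↦ ?_, fun h x hx ↦ ?_⟩
  · obtain ⟨x, hx⟩ := alcove_nonempty (b := b) w
    have : k < level b w j + 1 := by
      exact_mod_cast (h hx : (k : ℝ) < _).trans (mem_strip_of_mem_alcove hx j).2
    omega
  · exact (Int.cast_le.2 h).trans_lt (mem_strip_of_mem_alcove hx j).1

lemma separates_iff {w w' : AffineWeyl P} {j : ι} {k : ℤ} :
    Separates b j k w w' ↔ b.IsPos j ∧ ((level b w j < k ∧ k ≤ level b w' j) ∨
      (k ≤ level b w j ∧ level b w' j < k)) := by
  simp only [Separates, alcove_subset_negSide_iff, alcove_subset_posSide_iff]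

lemma mem_fundJAlcove_iff {w : AffineWeyl P} :
    w ∈ fundJAlcove b J ↔ ∀ j, b.IsPos j → InJ b J j → level b w j = 0 := by
  refine ⟨fun h j hj hJ ↦ ?_, fun h x hx j hj hJ ↦ ?_⟩
  · obtain ⟨x, hx⟩ := alcove_nonempty (b := b) w
    have h1 := h hx j hj hJ
    have h2 := mem_strip_of_mem_alcove hx j
    have h3 : level b w j < 1 := by exact_mod_cast h2.1.trans h1.2
    have h4 : 0 < level b w j + 1 := by exact_mod_cast h1.1.trans h2.2
    omega
  · have h2 := mem_strip_of_mem_alcove hx j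
    rw [h j hj hJ, Int.cast_zero, zero_add] at h2
    exact h2

/-! ### Crossing a wall of an alcove -/

variable [P.IsReduced]

omit [P.IsRootSystem] in
/-- The alcoves `A_0` and `s_i` are separated only by the hyperplane of the affine simple root `α_i`:
for `i ∈ I^*` since `s_i` permutes the other positive roots, for `i = 0` since `⟨α, θ^∨⟩ ∈ {0, 1}` for
every positive root `α ≠ θ`. -/
lemma level_simpleA_of_isPos (i : Option b.support) {k : ι} (hk : b.IsPos k) :
    (k = affRoot b i → level b (simpleA b i) k = -1) ∧
    (k = negIdx P (affRoot b i) → level b (simpleA b i) k = 1) ∧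
    (k ≠ affRoot b i → k ≠ negIdx P (affRoot b i) → level b (simpleA b i) k = 0) := by
  cases i with
  | some i =>
    have h (k : ι) : level b (simpleA b (some i)) k = -negInd b (simpleW b i • k) := by
      rw [level]
      change P.root'In ℤ k 0 - _ = _
      rw [map_zero, zero_sub]
      rfl
    have hi := Base.isPos_of_mem_support i.2
    refine ⟨?_, ?_, fun hne _ ↦ ?_⟩
    · rintro rfl
      rw [h, affRoot, simpleW, ofIdx_smul_self, negInd_negIdx, negInd_of_isPos hi, sub_zero]
    · rintro rfl
      exact absurd hi (isPos_negIdx.1 hk)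
    · rw [h, negInd_of_isPos (isPos_simpleW_smul i hk hne), neg_zero]
  | none =>
    have h (k : ι) : level b (simpleA b none) k = P.pairingIn ℤ k (highestRoot b) -
        negInd b (weylGroup.ofIdx P (highestRoot b) • k) := rfl
    have hpos := isPos_highestRoot b
    rw [affRoot, negIdx_negIdx]
    refine ⟨?_, ?_, fun _ hne ↦ ?_⟩
    · rintro rfl
      exact absurd hpos (isPos_negIdx.1 hk)
    · rintro rfl
      rw [h, ofIdx_smul_self, negInd_negIdx, negInd_of_isPos hpos, P.pairingIn_same]
      norm_num
    · have h0 := pairingIn_highestRoot_nonneg hk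
      have h1 := pairingIn_highestRoot_le_one hne
      obtain h2 | h2 : P.pairingIn ℤ k (highestRoot b) = 0 ∨
        P.pairingIn ℤ k (highestRoot b) = 1 := by omega
      · rw [h, highestRoot_smul_eq_self h2, negInd_of_isPos hk, h2, sub_zero]
      · rw [h, negInd_of_not_isPos (not_isPos_highestRoot_smul h2), h2, sub_self]

omit [P.IsRootSystem] in
/-- Passing from the alcove `w` to `s_i w` decreases the level at the root `w⁻¹ α_i` by one and
leaves the levels at the roots other than `± w⁻¹ α_i` unchanged. -/
lemma level_simpleA_mul (i : Option b.support) (w : AffineWeyl P) (j : ι) :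
    (j = w.f⁻¹ • affRoot b i → level b (simpleA b i * w) j = level b w j - 1) ∧
    (j = negIdx P (w.f⁻¹ • affRoot b i) → level b (simpleA b i * w) j = level b w j + 1) ∧
    (j ≠ w.f⁻¹ • affRoot b i → j ≠ negIdx P (w.f⁻¹ • affRoot b i) →
      level b (simpleA b i * w) j = level b w j) := by
  have h1 : j = w.f⁻¹ • affRoot b i ↔ w.f • j = affRoot b i := by rw [eq_inv_smul_iff]
  have h2 : j = negIdx P (w.f⁻¹ • affRoot b i) ↔ w.f • j = negIdx P (affRoot b i) := by
    rw [← smul_negIdx, eq_inv_smul_iff]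
  rw [ne_eq, ne_eq, h1, h2, level_mul]
  generalize w.f • j = k
  by_cases hk : b.IsPos k
  · obtain ⟨ha, hb, hc⟩ := level_simpleA_of_isPos i hk
    rw [negInd_of_isPos hk]
    refine ⟨fun h ↦ ?_, fun h ↦ ?_, fun h h' ↦ ?_⟩
    · rw [ha h]; ring
    · rw [hb h]; ring
    · rw [hc h h']; ring
  · obtain ⟨ha, hb, hc⟩ := level_simpleA_of_isPos i (isPos_negIdx.2 hk)
    rw [level_negIdx] at ha hb hc
    rw [negInd_of_not_isPos hk]
    refine ⟨fun h ↦ ?_, fun h ↦ ?_, fun h h' ↦ ?_⟩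
    · linarith [hb (by rw [h])]
    · linarith [ha (by rw [h, negIdx_negIdx])]
    · linarith [hc (fun h1 ↦ h' (eq_negIdx_comm.1 h1.symm))
        (fun h1 ↦ h (by rw [← negIdx_negIdx (P := P) k, h1, negIdx_negIdx]))]

lemma simpleA_mul_mem_iff {w : AffineWeyl P} (hw : w ∈ fundJAlcove b J) (i : Option b.support) :
    simpleA b i * w ∈ fundJAlcove b J ↔ ¬ InJ b J (w.f⁻¹ • affRoot b i) := by
  rw [mem_fundJAlcove_iff] at hw ⊢
  refine ⟨fun h hJ ↦ ?_, fun hJ j hj hjJ ↦ ?_⟩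
  · by_cases hpos : b.IsPos (w.f⁻¹ • affRoot b i)
    · have h1 := (level_simpleA_mul i w _).1 rfl
      rw [h _ hpos hJ, hw _ hpos hJ] at h1
      omega
    · have hpos' := isPos_negIdx.2 hpos
      have hJ' := inJ_negIdx.2 hJ
      have h1 := (level_simpleA_mul i w _).2.1 rfl
      rw [h _ hpos' hJ', hw _ hpos' hJ'] at h1
      omega
  · rw [(level_simpleA_mul i w j).2.2, hw j hj hjJ]
    · rintro rfl
      exact hJ hjJ
    · rintro rfl
      exact hJ (inJ_negIdx.1 hjJ)

lemma negativeCrossing_simpleA_mul {w : AffineWeyl P} {i : Option b.support}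
    (hpos : b.IsPos (w.f⁻¹ • affRoot b i)) : NegativeCrossing b w (simpleA b i * w) := by
  set β := w.f⁻¹ • affRoot b i with hβ
  have h := (level_simpleA_mul i w β).1 rfl
  refine ⟨β, level b w β, ⟨separates_iff.2 ⟨hpos, Or.inr (by omega)⟩, fun j k hjk ↦ ?_⟩,
    alcove_subset_posSide_iff.2 le_rfl, alcove_subset_negSide_iff.2 (by omega)⟩
  obtain ⟨hj, hk⟩ := separates_iff.1 hjk
  obtain ⟨-, -, h3⟩ := level_simpleA_mul i w j
  by_cases hjβ : j = β
  · subst hjβ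
    exact ⟨rfl, by omega⟩
  · have := h3 hjβ fun h' ↦ isPos_negIdx.1 (h' ▸ hj) hpos
    omega

omit [P.IsCrystallographic] [Finite ι] [Nonempty ι] [P.IsRootSystem] [P.IsReduced] in
lemma separates_comm {w w' : AffineWeyl P} {j : ι} {k : ℤ} :
    Separates b j k w w' ↔ Separates b j k w' w := by
  simp only [Separates]
  tauto

omit [P.IsCrystallographic] [Finite ι] [Nonempty ι] [P.IsRootSystem] [P.IsReduced] in
lemma NegativeCrossing.symm {w w' : AffineWeyl P} (h : NegativeCrossing b w w') :
    PositiveCrossing b w' w := by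
  obtain ⟨j, k, ⟨h1, h2⟩, h3, h4⟩ := h
  exact ⟨j, k, ⟨separates_comm.1 h1, fun j' k' h ↦ h2 j' k' (separates_comm.1 h)⟩, h4, h3⟩

variable [P.IsIrreducible]

/-- An arrow out of `f(w)^J` decreases the level at the crossed wall, and its weight records the
change of the class of `wt(w)`. -/
lemma cls_wt_and_negativeCrossing_of_arrow {w : AffineWeyl P} {i : Option b.support}
    {α : P.corootSpan ℤ} {v : minReps b J}
    (h : Arrow b J i (monomial b J (mark b i) α) (minRep b J w.f) v) :
    cls b J (simpleA b i * w).wt = cls b J (w.wt + α) ∧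
      NegativeCrossing b w (simpleA b i * w) := by
  obtain ⟨hc, -, hpos, -⟩ := (arrow_minRep_iff i _ _ _).1 h
  have hcls : cls b J α = cls b J (rightQ (simpleA b i).wt w.f) :=
    (AddMonoidAlgebra.single_left_inj (mark_ne_zero i)).1 hc
  refine ⟨?_, negativeCrossing_simpleA_mul hpos⟩
  rw [mul_wt, cls_add, ← hcls, add_comm, cls_add]

end Crystallographic

end Alcoves

end JAlcove

end

theorem mainTheorem8 {ι M N : Type*} [Finite ι] [Nonempty ι]
    [AddCommGroup M] [Module ℝ M] [AddCommGroup N] [Module ℝ N]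
    (P : RootPairing ι ℝ M N) [P.IsRootSystem] [P.IsCrystallographic] [P.IsReduced]
    [P.IsIrreducible] (b : P.Base) (J : Set b.support)
    (w : JAlcove.AffineWeyl P) (hw : w ∈ JAlcove.fundJAlcove b J) (i : Option b.support) :
    (JAlcove.simpleA b i * w ∈ JAlcove.fundJAlcove b J ↔
      ∃ c v, JAlcove.Arrow b J i c (JAlcove.minRep b J w.f) v ∨
        JAlcove.Arrow b J i c v (JAlcove.minRep b J w.f)) ∧
    (JAlcove.simpleA b i * w ∈ JAlcove.fundJAlcove b J →
      (∃ α : P.corootSpan ℤ,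
        JAlcove.Arrow b J i (JAlcove.monomial b J (JAlcove.mark b i) α)
          (JAlcove.minRep b J w.f) (JAlcove.minRep b J (JAlcove.simpleA b i * w).f) ∨
        JAlcove.Arrow b J i (JAlcove.monomial b J (JAlcove.mark b i) α)
          (JAlcove.minRep b J (JAlcove.simpleA b i * w).f) (JAlcove.minRep b J w.f)) ∧
      (∀ α : P.corootSpan ℤ,
        JAlcove.Arrow b J i (JAlcove.monomial b J (JAlcove.mark b i) α)
          (JAlcove.minRep b J w.f) (JAlcove.minRep b J (JAlcove.simpleA b i * w).f) →
        JAlcove.cls b J (JAlcove.simpleA b i * w).wt = JAlcove.cls b J (w.wt + α) ∧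
          JAlcove.NegativeCrossing b w (JAlcove.simpleA b i * w)) ∧
      (∀ α : P.corootSpan ℤ,
        JAlcove.Arrow b J i (JAlcove.monomial b J (JAlcove.mark b i) α)
          (JAlcove.minRep b J (JAlcove.simpleA b i * w).f) (JAlcove.minRep b J w.f) →
        JAlcove.cls b J (JAlcove.simpleA b i * w).wt = JAlcove.cls b J (w.wt - α) ∧
          JAlcove.PositiveCrossing b w (JAlcove.simpleA b i * w))) := by
  open JAlcove in
  have hback : simpleA b i * (simpleA b i * w) = w := simpleA_mul_simpleA_mul i w
  have hexists (h : simpleA b i * w ∈ fundJAlcove b J) : ∃ α : P.corootSpan ℤ,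
      Arrow b J i (monomial b J (mark b i) α) (minRep b J w.f) (minRep b J (simpleA b i * w).f) ∨
      Arrow b J i (monomial b J (mark b i) α) (minRep b J (simpleA b i * w).f)
        (minRep b J w.f) := by
    have hJ := (simpleA_mul_mem_iff hw i).1 h
    by_cases hpos : b.IsPos (w.f⁻¹ • affRoot b i)
    · exact ⟨_, Or.inl ((arrow_minRep_iff i _ _ _).2 ⟨rfl, rfl, hpos, hJ⟩)⟩
    · refine ⟨_, Or.inr ((arrow_minRep_iff i _ _ _).2 ⟨rfl, ?_, ?_, ?_⟩)⟩
      · rw [← mul_f, hback]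
      · rwa [inv_smul_simpleA_mul, isPos_negIdx]
      · rwa [inv_smul_simpleA_mul, inJ_negIdx]
  refine ⟨⟨fun h ↦ ?_, ?_⟩, fun h ↦ ⟨hexists h, fun α hα ↦ ?_, fun α hα ↦ ?_⟩⟩
  · obtain ⟨α, hα | hα⟩ := hexists h
    · exact ⟨_, _, Or.inl hα⟩
    · exact ⟨_, _, Or.inr hα⟩
  · rintro ⟨c, v, hv | hv⟩ <;> rw [simpleA_mul_mem_iff hw]
    · exact ((arrow_minRep_iff i _ _ _).1 hv).2.2.2
    · rw [← minRep_coe v, arrow_minRep_iff] at hv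
      -- The arrow ends at `f(w)^J = (s_i v)^J`, so `f(w)` and `s_i v` differ by an element of `W_J`.
      obtain ⟨-, hwv, -, hJ⟩ := hv
      obtain ⟨x, hx, hwx⟩ := exists_eq_minRep_mul b J w.f
      obtain ⟨y, hy, hvy⟩ := exists_eq_minRep_mul b J ((simpleA b i).f * v)
      have hmem : y⁻¹ * x ∈ fixModJ b J :=
        mul_mem (inv_mem (parabolic_le_fixModJ hy)) (parabolic_le_fixModJ hx)
      have hf : w.f = (simpleA b i).f * v * (y⁻¹ * x) := by
        rw [hvy, ← hwv, mul_assoc, mul_inv_cancel_left]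
        exact hwx
      rw [hf, mul_inv_rev, mul_smul, inJ_smul (inv_mem hmem), simpleA_f, inv_smul_ofIdx,
        inJ_negIdx]
      exact hJ
  · exact cls_wt_and_negativeCrossing_of_arrow hα
  · obtain ⟨h1, h2⟩ := cls_wt_and_negativeCrossing_of_arrow hα
    rw [hback] at h1 h2
    refine ⟨?_, h2.symm⟩
    rw [cls_sub, h1, cls_add, add_sub_cancel_right]
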